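/- Let $R$ be a commutative Noetherian ring and $M$ a finitely generated $R$-module. For a finitely generated $R$-module $N$ let $\dim_R N$ denote the Krull dimension of the support of $N$ (with $\dim_R 0=-\infty$). Call $N$ Cohen--Macaulay if $\operatorname{depth}_{R_P}N_P=\dim_{R_P}N_P$ for every maximal ideal $P$ in $\operatorname{Supp}_R N$; in particular $N=0$ is Cohen--Macaulay. Let $\mathcal S(M)=\{\dim_R N \mid 0\neq N\subseteq M \text{ a submodule}\}=\{d_1<d_2<\dots<d_\ell\}$, which is a finite set. The dimension filtration of $M$ is the chain $0=D_0\subsetneq D_1\subsetneq\dots\subsetneq D_\ell=M$ in which, for $1\le i\le \ell$, $D_i$ is the largest submodule of $M$ with $\dim_R D_i\le d_i$. The module $M$ is called sequentially Cohen--Macaulay if $D_i/D_{i-1}$ is Cohen--Macaulay for every $1\le i\le\ell$. Assume that $\dim R/\mathfrak p=\dim R_P/\mathfrak pR_P$ for every $\mathfrak p\in\operatorname{Ass}_R M$ and every maximal ideal $P$ of $R$ with $\mathfrak p\subseteq P$. Then the following conditions are equivalent: (1) $M$ is a sequentially Cohen--Macaulay $R$-module; (2) $M_P$ is a sequentially Cohen--Macaulay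 $R_P$-module for every $P\in\operatorname{Supp}_R M$. -/

import Mathlib

namespace SeqCM

/-- The depth of a module over a local ring: the supremum of the lengths of the `M`-regular
sequences consisting of elements of the maximal ideal. -/
noncomputable def localDepth (R : Type*) [CommRing R] [IsLocalRing R]
    (M : Type*) [AddCommGroup M] [Module R M] : ℕ∞ :=
  ⨆ (rs : List R) (_ : (∀ r ∈ rs, r ∈ IsLocalRing.maximalIdeal R) ∧
    RingTheory.Sequence.IsRegular M rs), (rs.length : ℕ∞)

/-- A finitely generated module `M` over a Noetherian ring `R` is Cohen-Macaulay if
`depth M_P = dim M_P` over `R_P` for every maximal ideal `P` in the support of `M`.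
In particular the zero module is Cohen-Macaulay. -/
def IsCohenMacaulay (R : Type*) [CommRing R] (M : Type*) [AddCommGroup M] [Module R M] : Prop :=
  ∀ P ∈ Module.support R M, P.asIdeal.IsMaximal →
    (localDepth (Localization.AtPrime P.asIdeal) (LocalizedModule.AtPrime P.asIdeal M) :
      WithBot ℕ∞) =
    Module.supportDim (Localization.AtPrime P.asIdeal) (LocalizedModule.AtPrime P.asIdeal M)

/-- The set `𝒮(M)` of the dimensions of the nonzero submodules of `M`. -/
def dimSet (R : Type*) [CommRing R] (M : Type*) [AddCommGroup M] [Module R M] :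
    Set (WithBot ℕ∞) :=
  {e | ∃ N : Submodule R M, N ≠ ⊥ ∧ Module.supportDim R N = e}

/-- `D 0, …, D ℓ` is the dimension filtration of `M`: the set `𝒮(M)` has exactly `ℓ` elements
`d 0 < ⋯ < d (ℓ - 1)`, `D 0` is zero, and `D (i + 1)` is the largest submodule of `M` of dimension
at most `d i`. (The indices of `d` start at `0` here.) -/
structure IsDimensionFiltration (R : Type*) [CommRing R] (M : Type*) [AddCommGroup M] [Module R M]
    (l : ℕ) (D : Fin (l + 1) → Submodule R M) : Prop where
  bot : D 0 = ⊥
  largest : ∃ d : Fin l → WithBot ℕ∞, StrictMono d ∧ Set.range d = dimSet R M ∧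
    ∀ i : Fin l, IsGreatest {N : Submodule R M | Module.supportDim R N ≤ d i} (D i.succ)

/-- `M` is sequentially Cohen-Macaulay if the successive quotients `D (i + 1) / D i` of its
dimension filtration are Cohen-Macaulay. (A finitely generated module over a Noetherian ring has
exactly one dimension filtration, see below.) -/
def IsSequentiallyCohenMacaulay (R : Type*) [CommRing R] (M : Type*) [AddCommGroup M]
    [Module R M] : Prop :=
  ∃ (l : ℕ) (D : Fin (l + 1) → Submodule R M), IsDimensionFiltration R M l D ∧
    ∀ i : Fin l, IsCohenMacaulay R (D i.succ ⧸ (D i.castSucc).submoduleOf (D i.succ))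

section WellDefined

variable {R : Type*} [CommRing R] {M : Type*} [AddCommGroup M] [Module R M]

theorem supportDim_sup_le (N K : Submodule R M) (e : WithBot ℕ∞)
    (hN : Module.supportDim R N ≤ e) (hK : Module.supportDim R K ≤ e) :
    Module.supportDim R (N ⊔ K : Submodule R M) ≤ e := by
  have hsub : Module.support R (N ⊔ K : Submodule R M) ⊆
      Module.support R N ∪ Module.support R K := by
    intro p hp
    rw [Module.mem_support_iff'] at hp
    obtain ⟨⟨m, hm⟩, h⟩ := hp
    by_contra hcon
    simp only [Set.mem_union, not_or, Module.notMem_support_iff'] at hcon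
    obtain ⟨a, ha, b, hb, rfl⟩ := Submodule.mem_sup.1 hm
    obtain ⟨r, hr, hra⟩ := hcon.1 ⟨a, ha⟩
    obtain ⟨s, hs, hsb⟩ := hcon.2 ⟨b, hb⟩
    have hra' : r • a = 0 := congrArg Subtype.val hra
    have hsb' : s • b = 0 := congrArg Subtype.val hsb
    refine h (r * s) (fun hmem => ?_) ?_
    · exact (p.2.mem_or_mem hmem).elim hr hs
    · apply Subtype.ext
      change (r * s) • (a + b) = 0
      rw [smul_add, mul_smul, mul_smul, hsb', smul_zero, add_zero, smul_comm, hra', smul_zero]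
  refine iSup_le fun c => ?_
  have key : ∀ L : Submodule R M, (c.head : PrimeSpectrum R) ∈ Module.support R L →
      (c.length : WithBot ℕ∞) ≤ Module.supportDim R L := by
    intro L hL
    exact Order.LTSeries.length_le_krullDim (α := Module.support R L)
      { length := c.length
        toFun := fun i => ⟨(c i).1, Module.mem_support_mono (c.monotone (Fin.zero_le i)) hL⟩
        step := fun i => c.step i }
  rcases hsub c.head.2 with h | h
  · exact (key N h).trans hN
  · exact (key K h).trans hK

theorem exists_isGreatest [IsNoetherian R M] (e : WithBot ℕ∞) :
    ∃ D, IsGreatest {N : Submodule R M | Module.supportDim R N ≤ e} D := by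
  obtain ⟨D, hD, hmax⟩ := WellFounded.has_min
    (wellFounded_gt : WellFounded ((· > ·) : Submodule R M → Submodule R M → Prop))
    {N : Submodule R M | Module.supportDim R N ≤ e}
    ⟨⊥, by simp [Module.supportDim_eq_bot_of_subsingleton]⟩
  refine ⟨D, hD, fun N hN => ?_⟩
  by_contra hcon
  exact hmax (D ⊔ N) (supportDim_sup_le D N e hD hN) (left_lt_sup.2 hcon)

theorem dimSet_finite [IsNoetherian R M] : (dimSet R M).Finite := by
  by_contra hinf
  have hinf : (dimSet R M).Infinite := hinf
  choose F hF using fun e : WithBot ℕ∞ => exists_isGreatest (R := R) (M := M) e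
  have hmono : ∀ a b, a < b → b ∈ dimSet R M → F a < F b := by
    rintro a b hab ⟨N, -, rfl⟩
    refine lt_of_le_of_ne ((hF _).2 ((hF a).1.trans hab.le)) fun h => ?_
    have hN : N ≤ F a := by
      rw [h]
      exact (hF (Module.supportDim R N)).2 (le_refl (Module.supportDim R N))
    exact absurd ((Module.supportDim_le_of_injective _
      (Submodule.inclusion_injective hN)).trans (hF a).1) (not_le.2 hab)
  have : WellFoundedGT (dimSet R M) := by
    refine ⟨Subrelation.wf (r := InvImage (· > ·) fun x : dimSet R M => F x.1) ?_
      (InvImage.wf _ wellFounded_gt)⟩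
    intro x y hxy
    exact hmono _ _ hxy x.2
  exact hinf (Set.finite_coe_iff.1 (Finite.of_wellFoundedLT_wellFoundedGT _))

theorem exists_isDimensionFiltration [IsNoetherian R M] :
    ∃ (l : ℕ) (D : Fin (l + 1) → Submodule R M), IsDimensionFiltration R M l D := by
  choose F hF using fun e : WithBot ℕ∞ => exists_isGreatest (R := R) (M := M) e
  have hfin := dimSet_finite (R := R) (M := M)
  refine ⟨hfin.toFinset.card, Fin.cons ⊥ fun i => F (hfin.toFinset.orderEmbOfFin rfl i),
    ⟨rfl, hfin.toFinset.orderEmbOfFin rfl, OrderEmbedding.strictMono _, ?_, fun i => ?_⟩⟩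
  · simp
  · simpa using hF _

theorem IsDimensionFiltration.length_unique {l l' : ℕ} {D : Fin (l + 1) → Submodule R M}
    {D' : Fin (l' + 1) → Submodule R M} (h : IsDimensionFiltration R M l D)
    (h' : IsDimensionFiltration R M l' D') : l = l' := by
  obtain ⟨d, hd, hr, -⟩ := h.largest
  obtain ⟨d', hd', hr', -⟩ := h'.largest
  have h1 := Set.ncard_range_of_injective hd.injective
  have h2 := Set.ncard_range_of_injective hd'.injective
  rw [hr] at h1
  rw [hr'] at h2
  simpa using h1.symm.trans h2

theorem IsDimensionFiltration.unique {l : ℕ} {D D' : Fin (l + 1) → Submodule R M}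
    (h : IsDimensionFiltration R M l D) (h' : IsDimensionFiltration R M l D') : D = D' := by
  obtain ⟨d, hd, hr, hD⟩ := h.largest
  obtain ⟨d', hd', hr', hD'⟩ := h'.largest
  obtain rfl : d = d' := (StrictMono.range_inj hd hd').1 (hr.trans hr'.symm)
  funext i
  refine Fin.cases ?_ (fun i => ?_) i
  · rw [h.bot, h'.bot]
  · exact (hD i).unique (hD' i)

end WellDefined

end SeqCM

/-! Index the filtration by all natural numbers: let `T_n` be the largest submodule of dimension
less than `n` (`dimTrunc`) and `C_n = T_{n+1}/T_n` (`dimGraded`). Values of `n` outside `𝒮(M)` only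
add zero pieces, so for finite-dimensional `M` sequential Cohen-Macaulayness means that every `C_n`
is Cohen-Macaulay (`isSequentiallyCohenMacaulay_iff`).

The submodule `T_n` is pinned down by associated primes: `dim T_n < n`, and every associated prime
of `M/T_n` has dimension at least `n` (`eq_dimTrunc`). If `dim R/p = dim R_P/pR_P + c` with one
constant `c` for all associated primes `p ⊆ P` of `M`, this description localizes, and `C_n(M_P)` is
the localization of `C_{n+c}(M)` (`nonempty_dimGraded_localization`).

For `P` maximal the hypothesis gives `c = 0`, whence (2) implies (1). For (1) implies (2), choose a
maximal `m ⊇ P`, and let `c = dim R_m/PR_m`. Each associated prime `p ⊆ P` of `M` is associated to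
some `C_n`. That module is Cohen-Macaulay, hence unmixed at `m` and at `P`, and its dimension drops
by exactly `c` between them, so the shift is constant (`ringKrullDim_quotient_eq_add`).
Cohen-Macaulayness itself passes from `m` to `P` by `IsCMOfDim.exists_localization`. -/

namespace SeqCM

/-! ### Dimension of a finite module through its associated primes. -/

section Dimension

variable {R : Type*} [CommRing R] {N : Type*} [AddCommGroup N] [Module R N]

theorem ringKrullDim_quotient_eq_coheight (p : PrimeSpectrum R) :
    ringKrullDim (R ⧸ p.asIdeal) = Order.coheight p := by
  rw [ringKrullDim_quotient, Order.coheight_eq_krullDim_Ici]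
  have : PrimeSpectrum.zeroLocus (p.asIdeal : Set R) = Set.Ici p := by
    ext q
    simp [PrimeSpectrum.mem_zeroLocus, ← PrimeSpectrum.asIdeal_le_asIdeal]
  rw [this]

theorem ringKrullDim_quotient_succ_le_of_lt {p q : Ideal R} [hp : p.IsPrime] [hq : q.IsPrime]
    (h : p < q) : ringKrullDim (R ⧸ q) + 1 ≤ ringKrullDim (R ⧸ p) := by
  have := Order.coheight_add_one_le (a := (⟨q, hq⟩ : PrimeSpectrum R)) (b := ⟨p, hp⟩) h
  have h1 := ringKrullDim_quotient_eq_coheight (⟨q, hq⟩ : PrimeSpectrum R)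
  have h2 := ringKrullDim_quotient_eq_coheight (⟨p, hp⟩ : PrimeSpectrum R)
  simp only at h1 h2
  rw [h1, h2]
  exact_mod_cast this

theorem mem_support_of_mem_associatedPrimes {p : PrimeSpectrum R}
    (hp : p.asIdeal ∈ associatedPrimes R N) : p ∈ Module.support R N := by
  obtain ⟨_, x, hx⟩ := hp
  refine Module.mem_support_iff'.2 ⟨x, fun r hr h0 => hr ?_⟩
  rw [hx]
  exact Ideal.le_radical (by simpa [Submodule.mem_colon_singleton] using h0)

theorem ringKrullDim_quotient_le_supportDim_of_mem_support {p : PrimeSpectrum R}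
    (hp : p ∈ Module.support R N) : ringKrullDim (R ⧸ p.asIdeal) ≤ Module.supportDim R N := by
  rw [ringKrullDim_quotient]
  exact Order.krullDim_le_of_strictMono
    (fun q => ⟨q.1, Module.mem_support_mono ((PrimeSpectrum.asIdeal_le_asIdeal _ _).1 q.2) hp⟩)
    fun _ _ h => h

theorem ringKrullDim_quotient_le_supportDim {p : Ideal R} (hp : p ∈ associatedPrimes R N) :
    ringKrullDim (R ⧸ p) ≤ Module.supportDim R N := by
  have hmem := mem_support_of_mem_associatedPrimes (p := ⟨p, hp.isPrime⟩) hp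
  have h := ringKrullDim_quotient_le_supportDim_of_mem_support hmem
  exact h

theorem zero_le_ringKrullDim_quotient {p : Ideal R} (hp : p ∈ associatedPrimes R N) :
    0 ≤ ringKrullDim (R ⧸ p) := by
  have := hp.isPrime
  exact ringKrullDim_nonneg_of_nontrivial

variable [IsNoetherianRing R] [Module.Finite R N]

theorem exists_mem_associatedPrimes_le {q : PrimeSpectrum R} (hq : q ∈ Module.support R N) :
    ∃ p ∈ associatedPrimes R N, p ≤ q.asIdeal := by
  obtain ⟨p, hp, hpq⟩ := Ideal.exists_minimalPrimes_le (Module.mem_support_iff_of_finite.1 hq)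
  exact ⟨p, Module.associatedPrimes.minimalPrimes_annihilator_subset_associatedPrimes R N hp, hpq⟩

/-- The dimension of a finitely generated module is governed by its associated primes. -/
theorem supportDim_lt_iff (n : ℕ) :
    Module.supportDim R N < n ↔ ∀ p ∈ associatedPrimes R N, ringKrullDim (R ⧸ p) < n := by
  refine ⟨fun h p hp => (ringKrullDim_quotient_le_supportDim hp).trans_lt h, fun h => ?_⟩
  by_contra! hcon
  obtain ⟨c, hc⟩ := Order.le_krullDim_iff.1 hcon
  obtain ⟨p, hp, hpc⟩ := exists_mem_associatedPrimes_le c.head.2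
  refine (h p hp).not_ge ?_
  have h1 := ringKrullDim_quotient_eq_coheight (⟨p, hp.isPrime⟩ : PrimeSpectrum R)
  simp only at h1
  rw [h1, ← hc]
  have := Order.length_le_coheight (x := (⟨p, hp.isPrime⟩ : PrimeSpectrum R))
    (p := c.map Subtype.val fun _ _ h => h) hpc
  exact_mod_cast this

end Dimension

/-! ### Regular sequences are no longer than the dimension of any associated prime. -/

section LocalRing

open IsLocalRing RingTheory.Sequence Pointwise

variable {A : Type*} [CommRing A] [IsNoetherianRing A] [IsLocalRing A]

/-- Let `K` be the elements killed by `p`. If `K ⊆ xN`, regularity of `x` gives `K = xK`, and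
Nakayama forces `K = 0`, which is false. So some `c ∈ K` survives in `N/xN`, where it is killed by
`p` and by `x ∉ p`. -/
theorem exists_mem_associatedPrimes_quotSMulTop {N : Type*} [AddCommGroup N] [Module A N]
    [Module.Finite A N] {x : A} (hx : x ∈ maximalIdeal A) (hreg : IsSMulRegular N x)
    {p : Ideal A} (hp : p ∈ associatedPrimes A N) :
    ∃ q ∈ associatedPrimes A (QuotSMulTop x N), p < q := by
  obtain ⟨hprime, y, hy⟩ := isAssociatedPrime_iff.1 hp
  have hpy : ∀ r, r ∈ p ↔ r • y = 0 := fun r => by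
    rw [hy, Submodule.mem_colon_singleton, Submodule.mem_bot]
  have hy0 : y ≠ 0 := fun h => hprime.ne_top <| (Ideal.eq_top_iff_one _).2 <| by simp [hpy, h]
  have hxp : x ∉ p := fun h => hy0 <|
    isSMulRegular_iff_right_eq_zero_of_smul.1 hreg y ((hpy x).1 h)
  let K : Submodule A N := ⨅ r : p, LinearMap.ker (LinearMap.lsmul A N r.1)
  have hK : ∀ c, c ∈ K ↔ ∀ r ∈ p, r • c = 0 := fun c => by simp [K]
  obtain ⟨c, hcK, hcx⟩ : ∃ c ∈ K, c ∉ (x • ⊤ : Submodule A N) := by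
    by_contra! hcon
    have hle : K ≤ maximalIdeal A • K := by
      intro c hc
      obtain ⟨d, -, rfl⟩ := Submodule.mem_smul_pointwise_iff_exists _ _ _ |>.1 (hcon c hc)
      refine Submodule.smul_mem_smul hx ((hK d).2 fun r hr => ?_)
      refine isSMulRegular_iff_right_eq_zero_of_smul.1 hreg _ ?_
      rw [smul_comm]
      exact (hK _).1 hc r hr
    have := Submodule.eq_bot_of_le_smul_of_le_jacobson_bot _ K (IsNoetherian.noetherian K) hle
      (jacobson_eq_maximalIdeal ⊥ bot_ne_top).ge
    exact hy0 <| (Submodule.mem_bot A).1 <| this ▸ (hK y).2 fun r hr => (hpy r).1 hr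
  obtain ⟨q, hq, hle⟩ := exists_le_isAssociatedPrime_of_isNoetherianRing A
    (Submodule.Quotient.mk c : QuotSMulTop x N)
    (fun h => hcx ((Submodule.Quotient.mk_eq_zero _).1 h))
  refine ⟨q, hq, lt_of_le_of_ne (fun r hr => hle ?_) fun h => hxp (h ▸ hle ?_)⟩
  · rw [Submodule.mem_colon_singleton, Submodule.mem_bot, ← Submodule.Quotient.mk_smul,
      (hK c).1 hcK r hr, Submodule.Quotient.mk_zero]
  · rw [Submodule.mem_colon_singleton, Submodule.mem_bot]
    exact Module.mem_annihilator.1 (QuotSMulTop.mem_annihilator (M := N) x) _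

/-- The length of a regular sequence is at most the dimension of `A ⧸ p`, for every associated
prime `p`. -/
theorem length_le_ringKrullDim_quotient {N : Type*} [AddCommGroup N] [Module A N]
    [Module.Finite A N] {rs : List A} (hmem : ∀ r ∈ rs, r ∈ maximalIdeal A)
    (hreg : IsRegular N rs) {p : Ideal A} (hp : p ∈ associatedPrimes A N) :
    (rs.length : WithBot ℕ∞) ≤ ringKrullDim (A ⧸ p) := by
  induction rs generalizing N p with
  | nil => simpa using zero_le_ringKrullDim_quotient hp
  | cons x rs ih =>
    obtain ⟨hx, hrs⟩ := (isRegular_cons_iff N x rs).1 hreg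
    -- Each regular element moves to a strictly larger associated prime, costing at least one
    -- dimension.
    obtain ⟨q, hq, hpq⟩ := exists_mem_associatedPrimes_quotSMulTop (hmem x (by simp)) hx hp
    have := hp.isPrime
    have := hq.isPrime
    have h1 := ih (fun r hr => hmem r (by simp [hr])) hrs hq
    refine le_trans ?_ (ringKrullDim_quotient_succ_le_of_lt hpq)
    simp only [List.length_cons, Nat.cast_add, Nat.cast_one]
    gcongr

end LocalRing

end SeqCM

namespace SeqCM

open IsLocalRing RingTheory.Sequence Pointwise

/-! ### Arithmetic of dimensions in `WithBot ℕ∞`. -/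

section Arithmetic

theorem withBot_add_natCast_eq_iff {a : WithBot ℕ∞} {n c : ℕ} :
    a + c = (n + c : ℕ) ↔ a = n := by
  induction a with
  | bot =>
    rw [WithBot.bot_add]
    exact iff_of_false (fun h => WithBot.coe_ne_bot h.symm) fun h => WithBot.coe_ne_bot h.symm
  | coe a =>
    norm_cast
    induction a with
    | top => exact iff_of_false (fun h => ENat.natCast_ne_top _ h.symm) fun h => ENat.natCast_ne_top _ h.symm
    | coe a => norm_cast; omega

theorem withBot_add_natCast_lt_iff {a : WithBot ℕ∞} {n c : ℕ} :
    a + c < (n + c : ℕ) ↔ a < n := by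
  induction a with
  | bot =>
    rw [WithBot.bot_add]
    exact iff_of_true (WithBot.bot_lt_coe _) (WithBot.bot_lt_coe _)
  | coe a =>
    norm_cast
    induction a with
    | top => exact iff_of_false not_top_lt not_top_lt
    | coe a => norm_cast; omega

theorem withBot_lt_succ_iff {a : WithBot ℕ∞} {n : ℕ} : a < (n + 1 : ℕ) ↔ a ≤ n := by
  induction a with
  | bot => exact iff_of_true (WithBot.bot_lt_coe _) bot_le
  | coe a =>
    norm_cast
    induction a with
    | top => exact iff_of_false not_top_lt (by simp)
    | coe a => norm_cast; omega

theorem withBot_lt_zero_iff {a : WithBot ℕ∞} : a < (0 : ℕ) ↔ a ≤ ⊥ := by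
  induction a with
  | bot => exact iff_of_true (WithBot.bot_lt_coe _) le_rfl
  | coe a => exact iff_of_false (by norm_cast; simp) (by simp)

theorem exists_natCast_eq {a : WithBot ℕ∞} (h : a ≠ ⊥) (htop : a < ⊤) : ∃ n : ℕ, a = n := by
  induction a with
  | bot => exact absurd rfl h
  | coe a =>
    induction a with
    | top => exact absurd htop (lt_irrefl _)
    | coe a => exact ⟨a, rfl⟩

theorem natCast_lt_top {n : ℕ} : (n : WithBot ℕ∞) < ⊤ :=
  WithBot.coe_lt_coe.2 (ENat.natCast_lt_top n)

end Arithmetic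

/-! ### Exchanging regular elements. -/

section Exchange

variable {A : Type*} [CommRing A] {N : Type*} [AddCommGroup N] [Module A N]

/-- Reducing modulo two elements does not depend on their order. -/
theorem nonempty_quotSMulTop_comm (N : Type*) [AddCommGroup N] [Module A N] (x y : A) :
    Nonempty (QuotSMulTop y (QuotSMulTop x N) ≃ₗ[A] QuotSMulTop x (QuotSMulTop y N)) := by
  have key : ∀ x y : A, Nonempty (QuotSMulTop y (QuotSMulTop x N) ≃ₗ[A]
      N ⧸ (Ideal.ofList [x, y] • ⊤ : Submodule A N)) := fun x y =>
    ⟨(Submodule.quotEquivOfEq _ _ (by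
      rw [Ideal.ofList_singleton, Submodule.ideal_span_singleton_smul])).trans
      (Submodule.quotOfListConsSMulTopEquivQuotSMulTopInner N x [y]).symm⟩
  obtain ⟨e⟩ := key x y
  obtain ⟨f⟩ := key y x
  have h : (Ideal.ofList [x, y] • ⊤ : Submodule A N) = Ideal.ofList [y, x] • ⊤ := by
    congr 1
    rw [Ideal.ofList_cons x, Ideal.ofList_cons y [x], Ideal.ofList_singleton, Ideal.ofList_singleton,
      sup_comm]
  exact ⟨e.trans ((Submodule.quotEquivOfEq _ _ h).trans f.symm)⟩

theorem isSMulRegular_quotSMulTop_iff {x y : A} :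
    IsSMulRegular (QuotSMulTop x N) y ↔ ∀ c d : N, y • c = x • d → ∃ e, c = x • e := by
  rw [isSMulRegular_quotient_iff_mem_of_smul_mem]
  simp only [Submodule.mem_smul_pointwise_iff_exists, Submodule.mem_top, true_and]
  exact ⟨fun h c d hcd => (h c ⟨d, hcd.symm⟩).imp fun _ => Eq.symm,
    fun h c ⟨d, hd⟩ => (h c d hd.symm).imp fun _ => Eq.symm⟩

/-- From `xc = yd`, regularity of `y` modulo `x` gives `d = xe`; cancelling `x` leaves `c = ye`. -/
theorem isSMulRegular_quotSMulTop_swap {x y : A} (hx : IsSMulRegular N x)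
    (hxy : IsSMulRegular (QuotSMulTop x N) y) : IsSMulRegular (QuotSMulTop y N) x := by
  rw [isSMulRegular_quotSMulTop_iff] at hxy ⊢
  intro c d hcd
  obtain ⟨e, rfl⟩ := hxy d c hcd.symm
  exact ⟨e, hx (by simp only; rw [hcd, smul_comm])⟩

theorem not_isSMulRegular_of_mem_associatedPrimes [IsNoetherianRing A] {p : Ideal A}
    (hp : p ∈ associatedPrimes A N) {z : A} (hz : z ∈ p) : ¬ IsSMulRegular N z := by
  have : z ∈ ⋃ p ∈ associatedPrimes A N, (p : Set A) := Set.mem_biUnion hp hz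
  rwa [biUnion_associatedPrimes_eq_compl_regular] at this

theorem isSMulRegular_of_notMem_associatedPrimes [IsNoetherianRing A] {z : A}
    (h : ∀ p ∈ associatedPrimes A N, z ∉ p) : IsSMulRegular N z := by
  by_contra hcon
  have : z ∈ ({r : A | IsSMulRegular N r}ᶜ : Set A) := hcon
  rw [← biUnion_associatedPrimes_eq_compl_regular] at this
  obtain ⟨p, hp, hz⟩ := Set.mem_iUnion₂.1 this
  exact h p hp hz

/-- Whether a prime is associated to `N ⧸ x N` does not depend on the choice of the regular
element `x` of that prime. -/
theorem mem_associatedPrimes_quotSMulTop_of_isSMulRegular [IsNoetherianRing A] {x y : A}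
    {p : Ideal A} (hyp : y ∈ p) (hx : IsSMulRegular N x) (hy : IsSMulRegular N y)
    (h : p ∈ associatedPrimes A (QuotSMulTop x N)) : p ∈ associatedPrimes A (QuotSMulTop y N) := by
  obtain ⟨hprime, u, hu⟩ := isAssociatedPrime_iff.1 h
  obtain ⟨c, rfl⟩ := Submodule.Quotient.mk_surjective _ u
  have hpu : ∀ r, r ∈ p ↔ ∃ e, r • c = x • e := fun r => by
    rw [hu, Submodule.mem_colon_singleton, Submodule.mem_bot, ← Submodule.Quotient.mk_smul,
      Submodule.Quotient.mk_eq_zero, Submodule.mem_smul_pointwise_iff_exists]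
    simp [eq_comm]
  -- If `c` represents the element modulo `x` with annihilator `p`, write `yc = xd`. Cancelling `x`
  -- or `y` shows that `rd ∈ yN` exactly when `rc ∈ xN`, so `d` modulo `y` also has annihilator `p`.
  obtain ⟨d, hd⟩ := (hpu y).1 hyp
  refine isAssociatedPrime_iff.2 ⟨hprime, Submodule.Quotient.mk d, ?_⟩
  ext r
  rw [Submodule.mem_colon_singleton, Submodule.mem_bot, ← Submodule.Quotient.mk_smul,
    Submodule.Quotient.mk_eq_zero, Submodule.mem_smul_pointwise_iff_exists, hpu]
  constructor
  · rintro ⟨e, he⟩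
    refine ⟨e, trivial, hx ?_⟩
    simp only
    rw [smul_comm x y e, ← he, smul_comm x r d, ← hd, smul_comm]
  · rintro ⟨e, -, he⟩
    refine ⟨e, hy ?_⟩
    simp only
    rw [smul_comm y r c, hd, smul_comm r x d, ← he, smul_comm]

end Exchange

/-! ### Depth and Cohen-Macaulay modules over a local ring. -/

section LocalRing

variable {A : Type*} [CommRing A] [IsLocalRing A]

/-- There is a regular sequence of length `n` on `N` in the maximal ideal of `A`. -/
def HasRegularSequence (A : Type*) [CommRing A] [IsLocalRing A] (N : Type*) [AddCommGroup N]
    [Module A N] (n : ℕ) : Prop :=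
  ∃ rs : List A, rs.length = n ∧ (∀ r ∈ rs, r ∈ maximalIdeal A) ∧ IsRegular N rs

theorem HasRegularSequence.congr {N N' : Type*} [AddCommGroup N] [Module A N] [AddCommGroup N']
    [Module A N'] (e : N ≃ₗ[A] N') {n : ℕ} (h : HasRegularSequence A N n) :
    HasRegularSequence A N' n := by
  obtain ⟨rs, hl, hmem, hreg⟩ := h
  exact ⟨rs, hl, hmem, (e.isRegular_congr rs).1 hreg⟩

theorem hasRegularSequence_zero {N : Type*} [AddCommGroup N] [Module A N] [Nontrivial N] :
    HasRegularSequence A N 0 :=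
  ⟨[], rfl, by simp, IsRegular.nil A N⟩

theorem HasRegularSequence.nontrivial {N : Type*} [AddCommGroup N] [Module A N] {n : ℕ}
    (h : HasRegularSequence A N n) : Nontrivial N := by
  obtain ⟨rs, -, -, hreg⟩ := h
  exact hreg.nontrivial

theorem hasRegularSequence_succ_iff {N : Type*} [AddCommGroup N] [Module A N] {n : ℕ} :
    HasRegularSequence A N (n + 1) ↔ ∃ x ∈ maximalIdeal A, IsSMulRegular N x ∧
      HasRegularSequence A (QuotSMulTop x N) n := by
  constructor
  · rintro ⟨_ | ⟨x, rs⟩, hl, hmem, hreg⟩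
    · simp at hl
    · obtain ⟨hx, hrs⟩ := (isRegular_cons_iff N x rs).1 hreg
      exact ⟨x, hmem x (by simp), hx, rs, by simpa using hl, fun r hr => hmem r (by simp [hr]), hrs⟩
  · rintro ⟨x, hxm, hx, rs, hl, hmem, hrs⟩
    exact ⟨x :: rs, by simp [hl], by simpa using ⟨hxm, hmem⟩, .cons hx hrs⟩

theorem nontrivial_quotSMulTop {N : Type*} [AddCommGroup N] [Module A N] [Module.Finite A N]
    [Nontrivial N] {x : A} (hx : x ∈ maximalIdeal A) : Nontrivial (QuotSMulTop x N) :=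
  Submodule.Quotient.nontrivial_iff.2 <|
    (Submodule.top_ne_pointwise_smul_of_mem_jacobson_annihilator
      (maximalIdeal_le_jacobson _ hx)).symm

theorem exists_mem_maximalIdeal_forall_notMem {s : Set (Ideal A)} (hs : s.Finite)
    (hprime : ∀ p ∈ s, p.IsPrime) (h : maximalIdeal A ∉ s) :
    ∃ z ∈ maximalIdeal A, ∀ p ∈ s, z ∉ p := by
  by_contra! hcon
  obtain ⟨p, hp, hle⟩ := (Ideal.subset_union_prime_finite hs (f := id) (I := maximalIdeal A) ⊥ ⊥
    fun p hp _ _ => hprime p hp).1 fun z hz => by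
      obtain ⟨p, hp, hzp⟩ := hcon z hz
      exact Set.mem_biUnion hp hzp
  refine h ?_
  rwa [(maximalIdeal.isMaximal A).eq_of_le (hprime p hp).ne_top hle]

/-- Reducing modulo any regular element shortens the available regular sequences by one. -/
theorem HasRegularSequence.quotSMulTop [IsNoetherianRing A] {n : ℕ} {N : Type*} [AddCommGroup N]
    [Module A N] [Module.Finite A N] (h : HasRegularSequence A N (n + 1)) {x : A}
    (hxm : x ∈ maximalIdeal A) (hx : IsSMulRegular N x) :
    HasRegularSequence A (QuotSMulTop x N) n := by
  induction n generalizing N x with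
  | zero =>
    have := h.nontrivial
    have := nontrivial_quotSMulTop (N := N) hxm
    exact hasRegularSequence_zero
  | succ n ih =>
    obtain ⟨y, hym, hy, hNy⟩ := hasRegularSequence_succ_iff.1 h
    obtain ⟨w, hwm, hw, -⟩ := hasRegularSequence_succ_iff.1 hNy
    have h1 : maximalIdeal A ∉ associatedPrimes A (QuotSMulTop y N) := fun hm =>
      not_isSMulRegular_of_mem_associatedPrimes hm hwm hw
    have h2 : maximalIdeal A ∉ associatedPrimes A (QuotSMulTop x N) := fun hm =>
      h1 (mem_associatedPrimes_quotSMulTop_of_isSMulRegular hym hx hy hm)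
    have h3 : maximalIdeal A ∉ associatedPrimes A N := fun hm =>
      not_isSMulRegular_of_mem_associatedPrimes hm hxm hx
    -- The maximal ideal is associated to none of `N`, `N/xN`, `N/yN`, so prime avoidance yields `z`
    -- regular on all three. The induction hypothesis then passes from `y` to `z` and from `z` to
    -- `x`, since the order of reduction is immaterial.
    obtain ⟨z, hzm, hz⟩ := exists_mem_maximalIdeal_forall_notMem
      (((associatedPrimes.finite A N).union (associatedPrimes.finite A (QuotSMulTop x N))).union
        (associatedPrimes.finite A (QuotSMulTop y N)))
      (by rintro p ((hp | hp) | hp) <;> exact hp.isPrime)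
      (by rintro ((hp | hp) | hp) <;> contradiction)
    have hzN : IsSMulRegular N z :=
      isSMulRegular_of_notMem_associatedPrimes fun p hp => hz p (.inl (.inl hp))
    have hzx : IsSMulRegular (QuotSMulTop x N) z :=
      isSMulRegular_of_notMem_associatedPrimes fun p hp => hz p (.inl (.inr hp))
    have hzy : IsSMulRegular (QuotSMulTop y N) z :=
      isSMulRegular_of_notMem_associatedPrimes fun p hp => hz p (.inr hp)
    obtain ⟨e⟩ := nonempty_quotSMulTop_comm N y z
    obtain ⟨f⟩ := nonempty_quotSMulTop_comm N z x
    have hNz : HasRegularSequence A (QuotSMulTop z N) (n + 1) := hasRegularSequence_succ_iff.2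
      ⟨y, hym, isSMulRegular_quotSMulTop_swap hy hzy, (ih hNy hzm hzy).congr e⟩
    exact hasRegularSequence_succ_iff.2
      ⟨z, hzm, hzx, (ih hNz hxm (isSMulRegular_quotSMulTop_swap hx hzx)).congr f⟩

/-- `N` is a nonzero Cohen-Macaulay module over the local ring `A`, of dimension `n`. -/
def IsCMOfDim (A : Type*) [CommRing A] [IsLocalRing A] (N : Type*) [AddCommGroup N]
    [Module A N] (n : ℕ) : Prop :=
  HasRegularSequence A N n ∧ Module.supportDim A N = n

theorem IsCMOfDim.congr {N N' : Type*} [AddCommGroup N] [Module A N] [AddCommGroup N']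
    [Module A N'] (e : N ≃ₗ[A] N') {n : ℕ} (h : IsCMOfDim A N n) : IsCMOfDim A N' n :=
  ⟨h.1.congr e, (Module.supportDim_eq_of_equiv e).symm.trans h.2⟩

theorem isCMOfDim_succ_iff [IsNoetherianRing A] {N : Type*} [AddCommGroup N] [Module A N]
    [Module.Finite A N] {n : ℕ} {x : A} (hxm : x ∈ maximalIdeal A) (hx : IsSMulRegular N x) :
    IsCMOfDim A N (n + 1) ↔ IsCMOfDim A (QuotSMulTop x N) n := by
  have hdim : Module.supportDim A N = (n + 1 : ℕ) ↔
      Module.supportDim A (QuotSMulTop x N) = n := by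
    rw [← Module.supportDim_quotSMulTop_succ_eq_supportDim hx hxm]
    exact withBot_add_natCast_eq_iff (c := 1)
  exact ⟨fun h => ⟨h.1.quotSMulTop hxm hx, hdim.1 h.2⟩,
    fun h => ⟨hasRegularSequence_succ_iff.2 ⟨x, hxm, hx, h.1⟩, hdim.2 h.2⟩⟩

/-- Unmixedness: `dim A/p` is squeezed between the length of a regular sequence and `dim N`, both
equal to `n`. -/
theorem IsCMOfDim.ringKrullDim_quotient_eq [IsNoetherianRing A] {N : Type*} [AddCommGroup N]
    [Module A N] [Module.Finite A N] {n : ℕ} (h : IsCMOfDim A N n) {p : Ideal A}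
    (hp : p ∈ associatedPrimes A N) : ringKrullDim (A ⧸ p) = n := by
  obtain ⟨⟨rs, rfl, hmem, hreg⟩, hdim⟩ := h
  exact le_antisymm ((ringKrullDim_quotient_le_supportDim hp).trans_eq hdim)
    (length_le_ringKrullDim_quotient hmem hreg hp)

/-- The supremum defining the depth is bounded by the finite dimension, so when it equals the
dimension it is attained by an actual sequence. -/
theorem localDepth_eq_supportDim_iff [IsNoetherianRing A] {N : Type*} [AddCommGroup N]
    [Module A N] [Module.Finite A N] [Nontrivial N] :
    (localDepth A N : WithBot ℕ∞) = Module.supportDim A N ↔ ∃ n, IsCMOfDim A N n := by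
  have hle : ∀ rs : List A, IsRegular N rs → (rs.length : WithBot ℕ∞) ≤ Module.supportDim A N := by
    intro rs hrs
    have : Nontrivial (N ⧸ Ideal.ofList rs • (⊤ : Submodule A N)) :=
      hrs.quot_ofList_smul_nontrivial ⊤
    have h0 := Module.supportDim_ne_bot_of_nontrivial A (N ⧸ Ideal.ofList rs • (⊤ : Submodule A N))
    rw [← Module.supportDim_add_length_eq_supportDim_of_isRegular rs hrs]
    generalize Module.supportDim A (N ⧸ Ideal.ofList rs • (⊤ : Submodule A N)) = a at h0
    induction a with
    | bot => exact absurd rfl h0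
    | coe a => norm_cast; exact le_add_self
  obtain ⟨d, hd⟩ := exists_natCast_eq (Module.supportDim_ne_bot_of_nontrivial A N)
    ((Module.supportDim_le_ringKrullDim A N).trans_lt ringKrullDim_lt_top)
  have hdepth : localDepth A N ≤ d := by
    refine iSup₂_le fun rs hrs => ?_
    have := hle rs hrs.2
    rw [hd] at this
    exact_mod_cast this
  constructor
  · intro h
    rw [hd] at h
    have h : localDepth A N = d := by exact_mod_cast h
    refine ⟨d, ?_, hd⟩
    by_contra hcon
    have hlt : ∀ rs : List A, (∀ r ∈ rs, r ∈ maximalIdeal A) ∧ IsRegular N rs →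
        rs.length < d := by
      intro rs hrs
      have := hle rs hrs.2
      rw [hd] at this
      refine lt_of_le_of_ne (by exact_mod_cast this) fun h => hcon ⟨rs, h, hrs⟩
    -- The empty sequence is regular, so `d - 1` below is a genuine predecessor.
    have hpos : 0 < d := hlt [] ⟨by simp, IsRegular.nil A N⟩
    have : localDepth A N ≤ (d - 1 : ℕ) := iSup₂_le fun rs hrs => by
      have := hlt rs hrs
      exact_mod_cast (by omega : rs.length ≤ d - 1)
    rw [h] at this
    have : d ≤ d - 1 := by exact_mod_cast this
    omega
  · rintro ⟨n, ⟨rs, hl, hmem, hreg⟩, hn⟩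
    have h1 : (n : ℕ∞) ≤ localDepth A N := by
      rw [← hl]
      exact le_iSup₂_of_le rs ⟨hmem, hreg⟩ le_rfl
    have h2 : d = n := by rw [hd] at hn; exact_mod_cast hn
    subst h2
    rw [hd, le_antisymm hdepth h1]
    rfl

end LocalRing

end SeqCM

namespace SeqCM

open IsLocalRing RingTheory.Sequence Pointwise

/-! ### Transport along ring isomorphisms, and Cohen-Macaulayness over local rings. -/

section RingEquiv

variable {A B : Type*} [CommRing A] [CommRing B] {N N' : Type*} [AddCommGroup N] [AddCommGroup N']
  [Module A N] [Module B N']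

theorem supportDim_le_of_semilinear (σ : A ≃+* B) (e : N ≃+ N')
    (he : ∀ a x, e (a • x) = σ a • e x) : Module.supportDim A N ≤ Module.supportDim B N' := by
  refine Order.krullDim_le_of_strictMono
    (fun q => ⟨PrimeSpectrum.comap (σ.symm : B →+* A) q.1, ?_⟩) fun p q h => ?_
  · obtain ⟨x, hx⟩ := Module.mem_support_iff'.1 q.2
    refine Module.mem_support_iff'.2 ⟨e x, fun b hb h0 => hx (σ.symm b) hb ?_⟩
    apply e.injective
    rw [he, σ.apply_symm_apply, h0, map_zero]
  · exact (PrimeSpectrum.comapEquiv σ.symm).symm.strictMono h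

theorem IsCMOfDim.of_semilinear [IsLocalRing A] [IsLocalRing B] (σ : A ≃+* B) (e : N ≃+ N')
    (he : ∀ a x, e (a • x) = σ a • e x) {n : ℕ} (h : IsCMOfDim A N n) : IsCMOfDim B N' n := by
  obtain ⟨⟨rs, hl, hmem, hreg⟩, hdim⟩ := h
  refine ⟨⟨rs.map σ, by simpa using hl, fun b hb => ?_, ?_⟩, ?_⟩
  · obtain ⟨a, ha, rfl⟩ := List.mem_map.1 hb
    have := hmem a ha
    rw [mem_maximalIdeal, mem_nonunits_iff] at this ⊢
    simpa using this
  · refine (e.isRegular_congr ?_).1 hreg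
    exact List.forall₂_map_right_iff.2 (List.forall₂_same.2 fun r _ x => he r x)
  · rw [← hdim]
    refine le_antisymm (supportDim_le_of_semilinear σ.symm e.symm fun b y => ?_)
      (supportDim_le_of_semilinear σ e he)
    apply e.injective
    rw [he]
    simp

end RingEquiv

section CohenMacaulay

theorem isCohenMacaulay_iff {R : Type*} [CommRing R] [IsNoetherianRing R] {N : Type*}
    [AddCommGroup N] [Module R N] [Module.Finite R N] :
    IsCohenMacaulay R N ↔ ∀ P ∈ Module.support R N, P.asIdeal.IsMaximal → ∃ n,
      IsCMOfDim (Localization.AtPrime P.asIdeal) (LocalizedModule.AtPrime P.asIdeal N) n := by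
  refine forall₂_congr fun P hP => imp_congr_right fun _ => ?_
  have : Nontrivial (LocalizedModule.AtPrime P.asIdeal N) := Module.mem_support_iff.1 hP
  exact localDepth_eq_supportDim_iff

/-- Elements outside the maximal ideal are already units, so localizing there changes ring and
module only up to isomorphism. -/
theorem isCohenMacaulay_iff_of_isLocalRing {A : Type*} [CommRing A] [IsNoetherianRing A]
    [IsLocalRing A] {N : Type*} [AddCommGroup N] [Module A N] [Module.Finite A N] :
    IsCohenMacaulay A N ↔ (Nontrivial N → ∃ n, IsCMOfDim A N n) := by
  have hunit : (maximalIdeal A).primeCompl ≤ IsUnit.submonoid A := fun a ha => by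
    have : IsUnit a := by simpa [Ideal.primeCompl] using ha
    exact this
  have : IsLocalization (maximalIdeal A).primeCompl A := IsLocalization.of_le_isUnit hunit
  have : IsLocalizedModule (maximalIdeal A).primeCompl (LinearMap.id : N →ₗ[A] N) :=
    isLocalizedModule_id _ N A
  let σ : A ≃ₐ[A] Localization.AtPrime (maximalIdeal A) :=
    IsLocalization.atUnits A (maximalIdeal A).primeCompl hunit
  let e : N ≃ₗ[A] LocalizedModule.AtPrime (maximalIdeal A) N :=
    IsLocalizedModule.linearEquiv (maximalIdeal A).primeCompl (LinearMap.id : N →ₗ[A] N)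
      (LocalizedModule.mkLinearMap (maximalIdeal A).primeCompl N)
  have he : ∀ (a : A) (x : N), e.toAddEquiv (a • x) = σ.toRingEquiv a • e.toAddEquiv x := by
    intro a x
    have : σ a = algebraMap A _ a := σ.commutes a
    change e (a • x) = σ a • e x
    rw [this, algebraMap_smul, map_smul]
  have key : ∀ n, IsCMOfDim A N n ↔ IsCMOfDim (Localization.AtPrime (maximalIdeal A))
      (LocalizedModule.AtPrime (maximalIdeal A) N) n := fun n =>
    ⟨fun h => h.of_semilinear _ _ he, fun h => h.of_semilinear σ.toRingEquiv.symm e.toAddEquiv.symm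
      fun b y => e.toAddEquiv.injective <| by rw [he]; simp⟩
  rw [isCohenMacaulay_iff]
  constructor
  · intro h hN
    have hmem : closedPoint A ∈ Module.support A N := by
      obtain ⟨q, hq⟩ := Module.nonempty_support_of_nontrivial (R := A) (M := N)
      exact Module.mem_support_mono (le_maximalIdeal q.2.ne_top) hq
    obtain ⟨n, hn⟩ := h (closedPoint A) hmem (maximalIdeal.isMaximal A)
    exact ⟨n, (key n).2 hn⟩
  · rintro h ⟨P, hPp⟩ hP hmax
    obtain rfl : P = maximalIdeal A := eq_maximalIdeal hmax
    have : Nontrivial N := by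
      by_contra hcon
      rw [not_nontrivial_iff_subsingleton] at hcon
      simp [Module.support_eq_empty] at hP
    obtain ⟨n, hn⟩ := h this
    exact ⟨n, (key n).1 hn⟩

end CohenMacaulay

/-! ### Localization of Cohen-Macaulay modules. -/

section Localization

variable {R : Type*} [CommRing R]

/-- The localization map `f` is arbitrary so that localized submodules and quotients can be used
directly. -/
theorem map_mem_associatedPrimes_iff (P : Ideal R) [P.IsPrime] [IsNoetherianRing R] {C : Type*}
    [AddCommGroup C] [Module R C] {C' : Type*} [AddCommGroup C'] [Module R C']
    [Module (Localization.AtPrime P) C'] [IsScalarTower R (Localization.AtPrime P) C']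
    (f : C →ₗ[R] C') [IsLocalizedModule P.primeCompl f] {p : Ideal R} [p.IsPrime] (hp : p ≤ P) :
    p.map (algebraMap R (Localization.AtPrime P)) ∈
      associatedPrimes (Localization.AtPrime P) C' ↔ p ∈ associatedPrimes R C := by
  rw [← Module.associatedPrimes.preimage_comap_associatedPrimes_eq_associatedPrimes_of_isLocalizedModule
    P.primeCompl (Localization.AtPrime P) f, Set.mem_preimage]
  have := Ideal.under_map_of_isLocalizationAtPrime (S := Localization.AtPrime P) P hp
  rw [Ideal.under] at this
  rw [this]

theorem exists_eq_map_of_isPrime (P : Ideal R) [P.IsPrime] (q : Ideal (Localization.AtPrime P))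
    [q.IsPrime] : ∃ p : Ideal R, p.IsPrime ∧ p ≤ P ∧
      q = p.map (algebraMap R (Localization.AtPrime P)) := by
  refine ⟨q.under R, inferInstance, ?_, (IsLocalization.map_under P.primeCompl _ q).symm⟩
  exact (Ideal.comap_mono (le_maximalIdeal Ideal.IsPrime.ne_top')).trans_eq
    (IsLocalization.AtPrime.under_maximalIdeal (Localization.AtPrime P) P)

theorem map_lt_map_of_lt (P : Ideal R) [P.IsPrime] {p q : Ideal R} [p.IsPrime] [q.IsPrime]
    (hpq : p < q) (hq : q ≤ P) : p.map (algebraMap R (Localization.AtPrime P)) <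
      q.map (algebraMap R (Localization.AtPrime P)) := by
  refine lt_of_le_of_ne (Ideal.map_mono hpq.le) fun h => hpq.ne ?_
  rw [← Ideal.under_map_of_isLocalizationAtPrime (S := Localization.AtPrime P) P hq, ← h,
    Ideal.under_map_of_isLocalizationAtPrime (S := Localization.AtPrime P) P (hpq.le.trans hq)]

theorem isSMulRegular_localization (P : Ideal R) [P.IsPrime] [IsNoetherianRing R] {C : Type*}
    [AddCommGroup C] [Module R C] {x : R} (hx : ∀ p ∈ associatedPrimes R C, p ≤ P → x ∉ p) :
    IsSMulRegular (LocalizedModule.AtPrime P C) (algebraMap R (Localization.AtPrime P) x) := by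
  refine isSMulRegular_of_notMem_associatedPrimes fun q hq hxq => ?_
  have := hq.isPrime
  obtain ⟨p, hp, hpP, rfl⟩ := exists_eq_map_of_isPrime P q
  refine hx p ((map_mem_associatedPrimes_iff P (LocalizedModule.mkLinearMap P.primeCompl C)
    hpP).1 hq) hpP ?_
  rw [← Ideal.under_map_of_isLocalizationAtPrime (S := Localization.AtPrime P) P hpP]
  exact hxq

theorem nonempty_quotSMulTop_localization (P : Ideal R) [P.IsPrime] (C : Type*)
    [AddCommGroup C] [Module R C] (x : R) :
    Nonempty (QuotSMulTop (algebraMap R (Localization.AtPrime P) x)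
      (LocalizedModule.AtPrime P C) ≃ₗ[Localization.AtPrime P]
        LocalizedModule.AtPrime P (QuotSMulTop x C)) := by
  refine ⟨(Submodule.quotEquivOfEq _ _ ?_).trans
    (localizedQuotientEquiv P.primeCompl (x • ⊤ : Submodule R C))⟩
  ext y
  rw [Submodule.mem_smul_pointwise_iff_exists, Submodule.localized, Submodule.mem_localized']
  constructor
  · rintro ⟨z, -, rfl⟩
    obtain ⟨⟨c, s⟩, rfl⟩ := IsLocalizedModule.mk'_surjective P.primeCompl
      (LocalizedModule.mkLinearMap P.primeCompl C) z
    refine ⟨x • c, Submodule.smul_mem_pointwise_smul _ _ _ trivial, s, ?_⟩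
    simp [IsLocalizedModule.mk'_smul]
  · rintro ⟨c, hc, s, rfl⟩
    obtain ⟨d, -, rfl⟩ := (Submodule.mem_smul_pointwise_iff_exists _ _ _).1 hc
    refine ⟨IsLocalizedModule.mk' (LocalizedModule.mkLinearMap P.primeCompl C) d s, trivial, ?_⟩
    simp [IsLocalizedModule.mk'_smul]

variable [IsNoetherianRing R]

/-- By unmixedness at `m`, no associated prime lies strictly below `P`. Hence the maximal ideal is
the only associated prime of `C_P`. -/
theorem isCMOfDim_localization_zero_of_mem_associatedPrimes {P m : Ideal R} [P.IsPrime] [m.IsPrime]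
    (hPm : P ≤ m) {C : Type*} [AddCommGroup C] [Module R C] [Module.Finite R C] {n : ℕ}
    (h : IsCMOfDim (Localization.AtPrime m) (LocalizedModule.AtPrime m C) n)
    (hP : P ∈ associatedPrimes R C) :
    IsCMOfDim (Localization.AtPrime P) (LocalizedModule.AtPrime P C) 0 := by
  have hdim : ∀ p ∈ associatedPrimes R C, p ≤ m → ringKrullDim (Localization.AtPrime m ⧸
      p.map (algebraMap R (Localization.AtPrime m))) = n := fun p hp hpm => by
    have := hp.isPrime
    exact h.ringKrullDim_quotient_eq
      ((map_mem_associatedPrimes_iff m (LocalizedModule.mkLinearMap m.primeCompl C) hpm).2 hp)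
  have hsupp := mem_support_of_mem_associatedPrimes (p := ⟨P, ‹_›⟩) hP
  have : Nontrivial (LocalizedModule.AtPrime P C) := Module.mem_support_iff.1 hsupp
  refine ⟨hasRegularSequence_zero, ?_⟩
  have hlt : Module.supportDim (Localization.AtPrime P) (LocalizedModule.AtPrime P C) <
      (1 : ℕ) := by
    refine (supportDim_lt_iff 1).2 fun q hq => ?_
    have := hq.isPrime
    obtain ⟨p, hp, hpP, rfl⟩ := exists_eq_map_of_isPrime P q
    have hpC := (map_mem_associatedPrimes_iff P (LocalizedModule.mkLinearMap P.primeCompl C)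
      hpP).1 hq
    obtain rfl | hlt := eq_or_lt_of_le hpP
    · rw [IsLocalization.AtPrime.map_eq_maximalIdeal p (Localization.AtPrime p)]
      have : ringKrullDim (Localization.AtPrime p ⧸ maximalIdeal (Localization.AtPrime p)) = 0 :=
        ringKrullDim_eq_zero_of_field (ResidueField (Localization.AtPrime p))
      rw [this]
      norm_num
    · exfalso
      have := Ideal.isPrime_map_of_isLocalizationAtPrime (S := Localization.AtPrime m) m
        (hpP.trans hPm)
      have := Ideal.isPrime_map_of_isLocalizationAtPrime (S := Localization.AtPrime m) m hPm
      have h1 := ringKrullDim_quotient_succ_le_of_lt (map_lt_map_of_lt m hlt hPm)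
      rw [hdim P hP hPm, hdim p hpC (hpP.trans hPm)] at h1
      have : n + 1 ≤ n := by exact_mod_cast h1
      omega
  have hne := Module.supportDim_ne_bot_of_nontrivial (Localization.AtPrime P)
    (LocalizedModule.AtPrime P C)
  generalize Module.supportDim (Localization.AtPrime P) (LocalizedModule.AtPrime P C) = a at *
  induction a with
  | bot => exact absurd rfl hne
  | coe a =>
    have : a < 1 := by exact_mod_cast hlt
    rw [Order.lt_one_iff] at this
    rw [this]
    rfl

/-- Localizing a Cohen-Macaulay module over a local ring at a prime of the support gives a
Cohen-Macaulay module, and the dimension drops by the dimension of the prime. -/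
theorem IsCMOfDim.exists_localization {P m : Ideal R} [hPp : P.IsPrime] [m.IsPrime] (hPm : P ≤ m)
    {n : ℕ} {C : Type*} [AddCommGroup C] [Module R C] [Module.Finite R C]
    (hP : (⟨P, hPp⟩ : PrimeSpectrum R) ∈ Module.support R C)
    (h : IsCMOfDim (Localization.AtPrime m) (LocalizedModule.AtPrime m C) n) :
    ∃ k : ℕ, IsCMOfDim (Localization.AtPrime P) (LocalizedModule.AtPrime P C) k ∧
      ringKrullDim (Localization.AtPrime m ⧸ P.map (algebraMap R (Localization.AtPrime m))) + k =
        n := by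
  have := Ideal.isPrime_map_of_isLocalizationAtPrime (S := Localization.AtPrime m) m hPm
  induction n using Nat.strong_induction_on generalizing C with
  | _ n ih =>
    have hdim := fun p (hp : p ∈ associatedPrimes R C) (hpm : p ≤ m) =>
      have := hp.isPrime
      h.ringKrullDim_quotient_eq
        ((map_mem_associatedPrimes_iff m (LocalizedModule.mkLinearMap m.primeCompl C) hpm).2 hp)
    by_cases hass : P ∈ associatedPrimes R C
    · exact ⟨0, isCMOfDim_localization_zero_of_mem_associatedPrimes hPm h hass, by
        rw [hdim P hass hPm]; simp⟩
    obtain ⟨p, hp, hpP⟩ := exists_mem_associatedPrimes_le hP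
    have hlt : p < P := lt_of_le_of_ne hpP fun h => hass (h ▸ hp)
    have := hp.isPrime
    have := Ideal.isPrime_map_of_isLocalizationAtPrime (S := Localization.AtPrime m) m
      (hpP.trans hPm)
    have h1 := ringKrullDim_quotient_succ_le_of_lt (map_lt_map_of_lt m hlt hPm)
    rw [hdim p hp (hpP.trans hPm)] at h1
    obtain _ | n := n
    -- The strict inclusion `p < P` needs at least one dimension, but `dim R_m/pR_m = 0`.
    · exfalso
      have h0 : 0 ≤ ringKrullDim (Localization.AtPrime m ⧸
        P.map (algebraMap R (Localization.AtPrime m))) := ringKrullDim_nonneg_of_nontrivial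
      have h2 : (1 : WithBot ℕ∞) ≤ 0 := by
        calc (1 : WithBot ℕ∞) = 0 + 1 := by simp
          _ ≤ _ := by gcongr
          _ ≤ _ := h1
          _ = 0 := by simp
      exact absurd h2 (by decide)
    -- Prime avoidance: were `P` inside an associated prime `q ⊆ m`, then `p < q` would contradict
    -- unmixedness. The resulting `x` is regular on both `C_m` and `C_P`.
    · obtain ⟨x, hxP, hx⟩ : ∃ x ∈ P, ∀ q ∈ associatedPrimes R C, q ≤ m → x ∉ q := by
        by_contra! hcon
        obtain ⟨q, ⟨hq, hqm⟩, hle⟩ := (Ideal.subset_union_prime_finite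
          (s := {q | q ∈ associatedPrimes R C ∧ q ≤ m}) (f := id) (I := P)
          ((associatedPrimes.finite R C).subset fun q hq => hq.1) ⊥ ⊥
          fun q hq _ _ => hq.1.isPrime).1 fun x hx => by
            obtain ⟨q, hq, hqm, hxq⟩ := hcon x hx
            exact Set.mem_biUnion (⟨hq, hqm⟩ : _ ∧ _) hxq
        have hle : P ≤ q := hle
        have := hq.isPrime
        have := Ideal.isPrime_map_of_isLocalizationAtPrime (S := Localization.AtPrime m) m hqm
        have h1 := ringKrullDim_quotient_succ_le_of_lt
          (map_lt_map_of_lt m (lt_of_lt_of_le hlt hle) hqm)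
        rw [hdim p hp (hpP.trans hPm), hdim q hq hqm] at h1
        have : n + 1 + 1 ≤ n + 1 := by exact_mod_cast h1
        omega
      have hmem : ∀ Q : Ideal R, ∀ [Q.IsPrime], P ≤ Q →
          algebraMap R (Localization.AtPrime Q) x ∈ maximalIdeal (Localization.AtPrime Q) :=
        fun Q _ hPQ => (IsLocalization.AtPrime.to_map_mem_maximal_iff _ Q x).2 (hPQ hxP)
      obtain ⟨e⟩ := nonempty_quotSMulTop_localization m C x
      obtain ⟨f⟩ := nonempty_quotSMulTop_localization P C x
      have hCx := ((isCMOfDim_succ_iff (hmem m hPm) (isSMulRegular_localization m hx)).1 h).congr e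
      have hPx : (⟨P, hPp⟩ : PrimeSpectrum R) ∈ Module.support R (QuotSMulTop x C) := by
        rw [Module.support_quotSMulTop]
        exact ⟨hP, by simpa using hxP⟩
      obtain ⟨k, hk, hkn⟩ := ih n n.lt_succ_self hPx hCx
      refine ⟨k + 1, (isCMOfDim_succ_iff (hmem P le_rfl) (isSMulRegular_localization P
        fun q hq hqP => hx q hq (hqP.trans hPm))).2 (hk.congr f.symm), ?_⟩
      push_cast
      rw [← add_assoc, hkn]

end Localization

end SeqCM

namespace SeqCM

/-! ### The truncations `T_n` and their associated primes. -/

section Truncation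

variable {R : Type*} [CommRing R] {M : Type*} [AddCommGroup M] [Module R M]

variable (R M) in
/-- The largest submodule of dimension less than `n`. -/
def dimTrunc (n : ℕ) : Submodule R M :=
  sSup {N | Module.supportDim R N < n}

theorem isGreatest_dimTrunc [IsNoetherian R M] (n : ℕ) :
    IsGreatest {N : Submodule R M | Module.supportDim R N < n} (dimTrunc R M n) := by
  suffices h : ∃ D, IsGreatest {N : Submodule R M | Module.supportDim R N < n} D by
    obtain ⟨D, hD⟩ := h
    rwa [dimTrunc, hD.isLUB.sSup_eq]
  obtain _ | n := n
  · simp_rw [withBot_lt_zero_iff]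
    exact exists_isGreatest ⊥
  · simp_rw [withBot_lt_succ_iff]
    exact exists_isGreatest _

theorem supportDim_dimTrunc_lt [IsNoetherian R M] (n : ℕ) :
    Module.supportDim R (dimTrunc R M n) < n :=
  (isGreatest_dimTrunc n).1

theorem le_dimTrunc {n : ℕ} {N : Submodule R M} (h : Module.supportDim R N < n) :
    N ≤ dimTrunc R M n :=
  le_sSup h

theorem ringKrullDim_quotient_le_of_le {p q : Ideal R} (h : p ≤ q) :
    ringKrullDim (R ⧸ q) ≤ ringKrullDim (R ⧸ p) :=
  ringKrullDim_le_of_surjective (Ideal.Quotient.factor h) (Ideal.Quotient.factor_surjective h)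

variable (R M) in
/-- The subquotient of `M` of dimension `n`. -/
abbrev dimGraded (n : ℕ) : Type _ :=
  dimTrunc R M (n + 1) ⧸ (dimTrunc R M n).submoduleOf (dimTrunc R M (n + 1))

theorem associatedPrimes_dimGraded_subset (n : ℕ) :
    associatedPrimes R (dimGraded R M n) ⊆ associatedPrimes R (M ⧸ dimTrunc R M n) := by
  refine associatedPrimes.subset_of_injective (f := Submodule.mapQ _ _
    (dimTrunc R M (n + 1)).subtype le_rfl) ?_
  rw [← LinearMap.ker_eq_bot]
  exact Submodule.ker_liftQ_eq_bot _ _ _ (by simp [LinearMap.ker_comp, Submodule.submoduleOf])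

variable [IsNoetherianRing R] [Module.Finite R M]

/-- A nonzero image of `T_n` in `M/E` would have an associated prime of dimension both at least `n`
and less than `n`. This criterion is what survives localization. -/
theorem eq_dimTrunc {n : ℕ} {E : Submodule R M} (hE : Module.supportDim R E < n)
    (hquot : ∀ p ∈ associatedPrimes R (M ⧸ E), (n : WithBot ℕ∞) ≤ ringKrullDim (R ⧸ p)) :
    E = dimTrunc R M n := by
  refine le_antisymm (le_dimTrunc hE) ?_
  by_contra hcon
  have hne : (dimTrunc R M n).map E.mkQ ≠ ⊥ := fun h => hcon <| by
    rwa [← LinearMap.le_ker_iff_map, Submodule.ker_mkQ] at h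
  have : Nontrivial ((dimTrunc R M n).map E.mkQ) := Submodule.nontrivial_iff_ne_bot.2 hne
  obtain ⟨p, hp⟩ := associatedPrimes.nonempty R ((dimTrunc R M n).map E.mkQ)
  have h1 := hquot p (associatedPrimes.subset_of_injective
    (Submodule.injective_subtype _) hp)
  have h2 : Module.supportDim R ((dimTrunc R M n).map E.mkQ) ≤
      Module.supportDim R (dimTrunc R M n) :=
    Module.supportDim_le_of_surjective (E.mkQ.submoduleMap _)
      (LinearMap.submoduleMap_surjective _ _)
  exact absurd (((h1.trans (ringKrullDim_quotient_le_supportDim hp)).trans h2).trans_lt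
    (supportDim_dimTrunc_lt n)) (lt_irrefl _)

/-- Otherwise a preimage `x` of an element with annihilator `p` could be adjoined to `T_n` without
reaching dimension `n`, against maximality. -/
theorem le_ringKrullDim_of_mem_associatedPrimes_quotient_dimTrunc {n : ℕ} {p : Ideal R}
    (hp : p ∈ associatedPrimes R (M ⧸ dimTrunc R M n)) :
    (n : WithBot ℕ∞) ≤ ringKrullDim (R ⧸ p) := by
  by_contra! hlt
  obtain ⟨hprime, u, hu⟩ := isAssociatedPrime_iff.1 hp
  obtain ⟨x, rfl⟩ := Submodule.mkQ_surjective _ u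
  let L : Submodule R M := dimTrunc R M n ⊔ Submodule.span R {x}
  have hle : dimTrunc R M n ≤ L := le_sup_left
  have hL : Module.supportDim R L < n := by
    refine (supportDim_lt_iff n).2 fun q hq => ?_
    have hexact : Function.Exact (Submodule.inclusion hle)
        ((dimTrunc R M n).mkQ.submoduleMap L) := by
      intro y
      rw [← Subtype.coe_inj, LinearMap.submoduleMap_coe_apply, ZeroMemClass.coe_zero,
        Submodule.mkQ_apply, Submodule.Quotient.mk_eq_zero]
      exact ⟨fun h => ⟨⟨y, h⟩, rfl⟩, by rintro ⟨z, rfl⟩; exact z.2⟩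
    rcases associatedPrimes.subset_union_of_exact (Submodule.inclusion_injective hle) hexact hq
      with h | h
    · exact (supportDim_lt_iff n).1 (supportDim_dimTrunc_lt n) q h
    · refine (ringKrullDim_quotient_le_of_le ?_).trans_lt hlt
      refine le_trans ?_ h.annihilator_le
      intro r hr
      rw [Submodule.mem_annihilator]
      rintro ⟨y, hy⟩ -
      have hmap : L.map (dimTrunc R M n).mkQ = Submodule.span R {(dimTrunc R M n).mkQ x} := by
        simp [L, Submodule.map_sup, Submodule.map_span]
      rw [hmap] at hy
      obtain ⟨a, rfl⟩ := Submodule.mem_span_singleton.1 hy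
      rw [hu, Submodule.mem_colon_singleton, Submodule.mem_bot] at hr
      apply Subtype.ext
      change r • a • (dimTrunc R M n).mkQ x = 0
      rw [smul_comm, hr, smul_zero]
  have hx : x ∈ dimTrunc R M n :=
    le_dimTrunc hL (le_sup_right (a := dimTrunc R M n) (Submodule.mem_span_singleton_self x))
  refine hprime.ne_top ((Ideal.eq_top_iff_one _).2 ?_)
  rw [hu, Submodule.mem_colon_singleton, Submodule.mem_bot, one_smul, Submodule.mkQ_apply,
    Submodule.Quotient.mk_eq_zero]
  exact hx

/-- Since `dim R/p ≥ n > dim T_n`, some `s ∉ p` kills `T_n`. If `x` has annihilator `p` modulo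
`T_n`, then `sx` has annihilator `p` in `M`. -/
theorem associatedPrimes_quotient_dimTrunc_subset (n : ℕ) :
    associatedPrimes R (M ⧸ dimTrunc R M n) ⊆ associatedPrimes R M := by
  intro p hp
  have hdim := le_ringKrullDim_of_mem_associatedPrimes_quotient_dimTrunc hp
  obtain ⟨hprime, u, hu⟩ := isAssociatedPrime_iff.1 hp
  obtain ⟨x, rfl⟩ := Submodule.mkQ_surjective _ u
  have hmem : ∀ r, r ∈ p ↔ r • x ∈ dimTrunc R M n := fun r => by
    rw [hu, Submodule.mem_colon_singleton, Submodule.mem_bot, ← map_smul, Submodule.mkQ_apply,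
      Submodule.Quotient.mk_eq_zero]
  obtain ⟨s, hs, hsp⟩ : ∃ s ∈ Module.annihilator R (dimTrunc R M n), s ∉ p := by
    by_contra! hcon
    have h1 := ringKrullDim_quotient_le_supportDim_of_mem_support (p := ⟨p, hprime⟩)
      (Module.mem_support_iff_of_finite (M := dimTrunc R M n).2 hcon)
    exact absurd ((hdim.trans h1).trans_lt (supportDim_dimTrunc_lt n)) (lt_irrefl _)
  refine isAssociatedPrime_iff.2 ⟨hprime, s • x, ?_⟩
  ext r
  rw [Submodule.mem_colon_singleton, Submodule.mem_bot]
  constructor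
  · intro hr
    have := Module.mem_annihilator.1 hs ⟨r • x, (hmem r).1 hr⟩
    rw [smul_comm]
    exact congrArg Subtype.val this
  · intro h0
    refine (hprime.mem_or_mem ((hmem (r * s)).2 ?_)).resolve_right hsp
    rw [mul_smul, h0]
    exact zero_mem _

theorem supportDim_dimGraded_lt (n : ℕ) :
    Module.supportDim R (dimGraded R M n) < (n + 1 : ℕ) :=
  (Module.supportDim_le_of_surjective _ (Submodule.mkQ_surjective _)).trans_lt
    (supportDim_dimTrunc_lt _)

/-- An element with annihilator `p` generates a submodule of dimension at most `n`, so it lies in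
`T_{n+1}`; and `p` is too large in dimension to be associated to `T_n`. -/
theorem mem_associatedPrimes_dimGraded {n : ℕ} {p : Ideal R} (hp : p ∈ associatedPrimes R M)
    (hn : ringKrullDim (R ⧸ p) = n) : p ∈ associatedPrimes R (dimGraded R M n) := by
  obtain ⟨hprime, x, hx⟩ := isAssociatedPrime_iff.1 hp
  have hmem : ∀ r, r ∈ p ↔ r • x = 0 := fun r => by
    rw [hx, Submodule.mem_colon_singleton, Submodule.mem_bot]
  have hxT : x ∈ dimTrunc R M (n + 1) := by
    refine le_dimTrunc ((supportDim_lt_iff _).2 fun q hq => ?_)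
      (Submodule.mem_span_singleton_self x)
    rw [withBot_lt_succ_iff, ← hn]
    refine ringKrullDim_quotient_le_of_le (le_trans (fun r hr => ?_) hq.annihilator_le)
    rw [Submodule.mem_annihilator]
    rintro ⟨y, hy⟩ -
    obtain ⟨a, rfl⟩ := Submodule.mem_span_singleton.1 hy
    apply Subtype.ext
    change r • a • x = 0
    rw [smul_comm, (hmem r).1 hr, smul_zero]
  have hpT : p ∈ associatedPrimes R (dimTrunc R M (n + 1)) := by
    refine isAssociatedPrime_iff.2 ⟨hprime, ⟨x, hxT⟩, ?_⟩
    ext r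
    rw [hmem, Submodule.mem_colon_singleton, Submodule.mem_bot, ← Subtype.coe_inj]
    rfl
  rcases associatedPrimes.subset_union_of_exact (Submodule.injective_subtype _)
    (LinearMap.exact_subtype_mkQ ((dimTrunc R M n).submoduleOf (dimTrunc R M (n + 1)))) hpT
    with h | h
  · exfalso
    have hp' : p ∈ associatedPrimes R (dimTrunc R M n) := by
      refine associatedPrimes.subset_of_injective
        (f := ((dimTrunc R M (n + 1)).subtype.restrict fun y hy => hy :
          (dimTrunc R M n).submoduleOf (dimTrunc R M (n + 1)) →ₗ[R] dimTrunc R M n)) ?_ h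
      intro a b hab
      exact Subtype.ext (Subtype.ext (congrArg (fun z : dimTrunc R M n => (z : M)) hab))
    have := (supportDim_lt_iff n).1 (supportDim_dimTrunc_lt n) p hp'
    rw [hn] at this
    exact lt_irrefl _ this
  · exact h

end Truncation

/-! ### Comparison with the dimension filtration. -/

section Filtration

variable {R : Type*} [CommRing R] {M : Type*} [AddCommGroup M] [Module R M]

theorem isCohenMacaulay_of_subsingleton [Subsingleton M] : IsCohenMacaulay R M := by
  intro P hP
  simp [Module.support_eq_empty] at hP

/-- No nonzero submodule has dimension strictly between consecutive values of `d`, or below the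
first, so "less than `d i`" selects the preceding term. -/
theorem eq_dimTrunc_of_isDimensionFiltration [IsNoetherian R M] {l : ℕ}
    {D : Fin (l + 1) → Submodule R M} (hbot : D 0 = ⊥) {d : Fin l → WithBot ℕ∞}
    (hd : StrictMono d) (hr : Set.range d = dimSet R M)
    (hD : ∀ i : Fin l, IsGreatest {N : Submodule R M | Module.supportDim R N ≤ d i} (D i.succ))
    {i : Fin l} {n : ℕ} (hn : d i = n) :
    D i.succ = dimTrunc R M (n + 1) ∧ D i.castSucc = dimTrunc R M n := by
  have hmem : ∀ N : Submodule R M, N ≠ ⊥ → ∃ k, d k = Module.supportDim R N := fun N hN => by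
    have : Module.supportDim R N ∈ Set.range d := hr ▸ ⟨N, hN, rfl⟩
    exact this
  constructor
  · have h := isGreatest_dimTrunc (R := R) (M := M) (n + 1)
    simp_rw [withBot_lt_succ_iff, ← hn] at h
    exact (hD i).unique h
  · refine IsGreatest.unique ?_ (isGreatest_dimTrunc (R := R) (M := M) n)
    rcases Fin.eq_zero_or_eq_succ i.castSucc with h0 | ⟨j, hj⟩
    · rw [h0, hbot]
      refine ⟨?_, fun N hN => ?_⟩
      · change Module.supportDim R (⊥ : Submodule R M) < n
        rw [Module.supportDim_eq_bot_of_subsingleton]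
        exact WithBot.bot_lt_coe _
      · by_contra hcon
        obtain ⟨k, hk⟩ := hmem N fun h => hcon h.le
        have hik : i ≤ k := Fin.le_def.2 (by simp [show i.val = 0 from congrArg Fin.val h0])
        have hN : Module.supportDim R N < n := hN
        rw [← hk, ← hn] at hN
        exact absurd (hd.monotone hik) hN.not_ge
    · have hji : j.val + 1 = i.val := (congrArg Fin.val hj).symm
      rw [hj]
      refine ⟨?_, fun N hN => ?_⟩
      · have hlt : d j < d i := hd (Fin.lt_def.2 (by omega))
        rw [hn] at hlt
        exact lt_of_le_of_lt (hD j).1 hlt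
      · by_cases hN0 : N = ⊥
        · simp [hN0]
        obtain ⟨k, hk⟩ := hmem N hN0
        have hN : Module.supportDim R N < n := hN
        rw [← hk, ← hn] at hN
        have hki := Fin.lt_def.1 (hd.lt_iff_lt.1 hN)
        refine (hD j).2 ?_
        change Module.supportDim R N ≤ d j
        rw [← hk]
        exact hd.monotone (Fin.le_def.2 (by omega))

/-- A finite dimensional module is sequentially Cohen-Macaulay if and only if all its graded pieces
with respect to dimension are Cohen-Macaulay. -/
theorem isSequentiallyCohenMacaulay_iff [IsNoetherian R M] {b : ℕ}
    (hb : Module.supportDim R M < b) :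
    IsSequentiallyCohenMacaulay R M ↔ ∀ n, IsCohenMacaulay R (dimGraded R M n) := by
  constructor
  · rintro ⟨l, D, ⟨hbot, d, hd, hr, hD⟩, hCM⟩ n
    by_cases hn : (n : WithBot ℕ∞) ∈ dimSet R M
    · rw [← hr] at hn
      obtain ⟨i, hi⟩ := hn
      obtain ⟨h1, h2⟩ := eq_dimTrunc_of_isDimensionFiltration hbot hd hr hD hi
      have := hCM i
      rwa [h1, h2] at this
    -- When `n` is not the dimension of a nonzero submodule, the truncation does not jump and the
    -- piece is zero.
    · have hle : dimTrunc R M (n + 1) ≤ dimTrunc R M n := by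
        refine le_dimTrunc (lt_of_le_of_ne (withBot_lt_succ_iff.1 (supportDim_dimTrunc_lt _))
          fun h => hn ⟨_, fun h0 => ?_, h⟩)
        rw [h0, Module.supportDim_eq_bot_of_subsingleton] at h
        exact WithBot.coe_ne_bot h.symm
      have : Subsingleton (dimGraded R M n) :=
        Submodule.Quotient.subsingleton_iff.2 (Submodule.submoduleOf_eq_top.2 hle)
      exact isCohenMacaulay_of_subsingleton
  · intro h
    obtain ⟨l, D, hfil⟩ := exists_isDimensionFiltration (R := R) (M := M)
    refine ⟨l, D, hfil, fun i => ?_⟩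
    obtain ⟨hbot, d, hd, hr, hD⟩ := hfil
    obtain ⟨N, hN, hNd⟩ : d i ∈ dimSet R M := hr ▸ Set.mem_range_self i
    have := Submodule.nontrivial_iff_ne_bot.2 hN
    obtain ⟨n, hn⟩ := exists_natCast_eq (Module.supportDim_ne_bot_of_nontrivial R N)
      ((Module.supportDim_le_of_injective _ N.injective_subtype).trans_lt hb |>.trans
        natCast_lt_top)
    obtain ⟨h1, h2⟩ := eq_dimTrunc_of_isDimensionFiltration hbot hd hr hD (hNd.symm.trans hn)
    rw [h1, h2]
    exact h n

end Filtration

end SeqCM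

namespace SeqCM

/-! ### Localizing the truncations. -/

section LocalizedFiltration

variable {R : Type*} [CommRing R]

theorem nonempty_subquotient_localization {M : Type*} [AddCommGroup M] [Module R M]
    (S : Submonoid R) (X Y : Submodule R M) :
    Nonempty ((X.localized S ⧸ (Y.localized S).submoduleOf (X.localized S)) ≃ₗ[Localization S]
      LocalizedModule S (X ⧸ Y.submoduleOf X)) := by
  let f := X.toLocalized' (Localization S) S (LocalizedModule.mkLinearMap S M)
  have heq : (Y.localized S).submoduleOf (X.localized S) =
      (Y.submoduleOf X).localized' (Localization S) S f := by
    ext ⟨e, he⟩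
    rw [Submodule.mem_localized']
    constructor
    · intro hY
      -- Localization commutes with intersections, giving a numerator in both `X` and `Y`.
      have hXY : e ∈ (X ⊓ Y).localized S := by
        rw [Submodule.localized, Submodule.localized'_inf]
        exact ⟨he, hY⟩
      obtain ⟨y, hy, s, rfl⟩ := hXY
      refine ⟨⟨y, hy.1⟩, hy.2, s, ?_⟩
      rw [IsLocalizedModule.mk'_eq_iff]
      apply Subtype.ext
      change LocalizedModule.mkLinearMap S M y = s • IsLocalizedModule.mk' _ y s
      rw [IsLocalizedModule.mk'_cancel']
    · rintro ⟨y, hy, s, h⟩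
      rw [IsLocalizedModule.mk'_eq_iff] at h
      refine ⟨y, hy, s, ?_⟩
      rw [IsLocalizedModule.mk'_eq_iff]
      exact congrArg Subtype.val h
  have := IsLocalization.linearMap_compatibleSMul S (Localization S)
    (X.localized S ⧸ (Y.submoduleOf X).localized' (Localization S) S f)
    (LocalizedModule S (X ⧸ Y.submoduleOf X))
  have := IsLocalization.linearMap_compatibleSMul S (Localization S)
    (LocalizedModule S (X ⧸ Y.submoduleOf X))
    (X.localized S ⧸ (Y.submoduleOf X).localized' (Localization S) S f)
  exact ⟨(Submodule.quotEquivOfEq _ _ heq).trans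
    ((IsLocalizedModule.linearEquiv S ((Y.submoduleOf X).toLocalizedQuotient' (Localization S) S f)
      (LocalizedModule.mkLinearMap S _)).restrictScalars (Localization S))⟩

variable [IsNoetherianRing R] {M : Type*} [AddCommGroup M] [Module R M] [Module.Finite R M]

/-- Both conditions of `eq_dimTrunc` are tested on associated primes, where the constant shift turns
the bound `n + c` into `n`. -/
theorem localized_dimTrunc (P : Ideal R) [P.IsPrime] {c : ℕ}
    (h : ∀ p ∈ associatedPrimes R M, p ≤ P → ringKrullDim (R ⧸ p) =
      ringKrullDim (Localization.AtPrime P ⧸ p.map (algebraMap R (Localization.AtPrime P))) + c)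
    (n : ℕ) : (dimTrunc R M (n + c)).localized P.primeCompl =
      dimTrunc (Localization.AtPrime P) (LocalizedModule.AtPrime P M) n := by
  refine eq_dimTrunc ((supportDim_lt_iff n).2 fun q hq => ?_) fun q hq => ?_
  · have := hq.isPrime
    obtain ⟨p, hp, hpP, rfl⟩ := exists_eq_map_of_isPrime P q
    have hpT := (map_mem_associatedPrimes_iff P ((dimTrunc R M (n + c)).toLocalized' _
      P.primeCompl (LocalizedModule.mkLinearMap P.primeCompl M)) hpP).1 hq
    have h1 := (supportDim_lt_iff _).1 (supportDim_dimTrunc_lt (n + c)) p hpT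
    rwa [h p (associatedPrimes.subset_of_injective (Submodule.injective_subtype _) hpT) hpP,
      withBot_add_natCast_lt_iff] at h1
  · have := hq.isPrime
    obtain ⟨p, hp, hpP, rfl⟩ := exists_eq_map_of_isPrime P q
    have hpT := (map_mem_associatedPrimes_iff P ((dimTrunc R M (n + c)).toLocalizedQuotient' _
      P.primeCompl (LocalizedModule.mkLinearMap P.primeCompl M)) hpP).1 hq
    have h1 := le_ringKrullDim_of_mem_associatedPrimes_quotient_dimTrunc hpT
    by_contra! hlt
    rw [h p (associatedPrimes_quotient_dimTrunc_subset _ hpT) hpP] at h1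
    exact absurd (withBot_add_natCast_lt_iff.2 hlt) h1.not_gt

theorem nonempty_dimGraded_localization (P : Ideal R) [P.IsPrime] {c : ℕ}
    (h : ∀ p ∈ associatedPrimes R M, p ≤ P → ringKrullDim (R ⧸ p) =
      ringKrullDim (Localization.AtPrime P ⧸ p.map (algebraMap R (Localization.AtPrime P))) + c)
    (n : ℕ) : Nonempty (dimGraded (Localization.AtPrime P) (LocalizedModule.AtPrime P M) n
      ≃ₗ[Localization.AtPrime P] LocalizedModule.AtPrime P (dimGraded R M (n + c))) := by
  have e := nonempty_subquotient_localization P.primeCompl (dimTrunc R M (n + c + 1))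
    (dimTrunc R M (n + c))
  have h1 := localized_dimTrunc P h (n + 1)
  rw [Nat.add_right_comm] at h1
  rwa [localized_dimTrunc P h n, h1] at e

theorem exists_ringKrullDim_quotient_map_eq (m : Ideal R) [m.IsPrime] {p : Ideal R} [p.IsPrime]
    (hp : p ≤ m) : ∃ n : ℕ, ringKrullDim (Localization.AtPrime m ⧸
      p.map (algebraMap R (Localization.AtPrime m))) = n := by
  have := Ideal.isPrime_map_of_isLocalizationAtPrime (S := Localization.AtPrime m) m hp
  refine exists_natCast_eq ?_ ((ringKrullDim_quotient_le _).trans_lt ringKrullDim_lt_top)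
  exact fun h => absurd (h ▸ ringKrullDim_nonneg_of_nontrivial (R := Localization.AtPrime m ⧸
      p.map (algebraMap R (Localization.AtPrime m)))) (by simp)

end LocalizedFiltration

/-! ### Passing between global and local dimensions. -/

section LocalToGlobal

variable {R : Type*} [CommRing R] [IsNoetherianRing R] {M : Type*} [AddCommGroup M] [Module R M]
  [Module.Finite R M]

/-- There are finitely many associated primes, and the hypothesis computes each dimension over a
Noetherian local ring, where it is finite. -/
theorem exists_supportDim_lt
    (hdim : ∀ p ∈ associatedPrimes R M, ∀ (P : Ideal R) [P.IsMaximal], p ≤ P →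
      ringKrullDim (R ⧸ p) =
        ringKrullDim (Localization.AtPrime P ⧸ p.map (algebraMap R (Localization.AtPrime P)))) :
    ∃ b : ℕ, Module.supportDim R M < b := by
  have : ∀ p : Ideal R, ∃ n : ℕ, p ∈ associatedPrimes R M → ringKrullDim (R ⧸ p) < n := by
    intro p
    by_cases hp : p ∈ associatedPrimes R M
    · have := hp.isPrime
      obtain ⟨m, hm, hpm⟩ := Ideal.exists_le_maximal p this.ne_top
      obtain ⟨n, hn⟩ := exists_ringKrullDim_quotient_map_eq m hpm
      exact ⟨n + 1, fun _ => withBot_lt_succ_iff.2 ((hdim p hp m hpm).trans hn).le⟩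
    · exact ⟨0, fun h => absurd h hp⟩
  choose g hg using this
  have hfin := associatedPrimes.finite R M
  refine ⟨hfin.toFinset.sup g, (supportDim_lt_iff _).2 fun p hp => (hg p hp).trans_le ?_⟩
  exact_mod_cast Finset.le_sup (f := g) (hfin.mem_toFinset.2 hp)

theorem supportDim_localization_dimGraded
    (hdim : ∀ p ∈ associatedPrimes R M, ∀ (P : Ideal R) [P.IsMaximal], p ≤ P →
      ringKrullDim (R ⧸ p) =
        ringKrullDim (Localization.AtPrime P ⧸ p.map (algebraMap R (Localization.AtPrime P))))
    {m : Ideal R} [m.IsMaximal] {p : Ideal R} {n : ℕ}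
    (hp : p ∈ associatedPrimes R M) (hpm : p ≤ m) (hn : ringKrullDim (R ⧸ p) = n) :
    Module.supportDim (Localization.AtPrime m) (LocalizedModule.AtPrime m (dimGraded R M n)) =
      n := by
  refine le_antisymm (withBot_lt_succ_iff.1 ((supportDim_lt_iff _).2 fun q hq => ?_)) ?_
  · have := hq.isPrime
    obtain ⟨q, hq', hqm, rfl⟩ := exists_eq_map_of_isPrime m q
    have hqC := (map_mem_associatedPrimes_iff m (LocalizedModule.mkLinearMap m.primeCompl _)
      hqm).1 hq
    rw [← hdim q (associatedPrimes_quotient_dimTrunc_subset n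
      (associatedPrimes_dimGraded_subset n hqC)) m hqm]
    exact (supportDim_lt_iff _).1 (supportDim_dimGraded_lt n) q hqC
  · have := hp.isPrime
    rw [← hn, hdim p hp m hpm]
    exact ringKrullDim_quotient_le_supportDim ((map_mem_associatedPrimes_iff m
      (LocalizedModule.mkLinearMap m.primeCompl _) hpm).2 (mem_associatedPrimes_dimGraded hp hn))

/-- If the graded pieces of `M` are Cohen-Macaulay, localizing at `P` shifts the dimensions of all
associated primes of `M` contained in `P` by the same amount. -/
theorem ringKrullDim_quotient_eq_add
    (hdim : ∀ p ∈ associatedPrimes R M, ∀ (P : Ideal R) [P.IsMaximal], p ≤ P →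
      ringKrullDim (R ⧸ p) =
        ringKrullDim (Localization.AtPrime P ⧸ p.map (algebraMap R (Localization.AtPrime P))))
    (hCM : ∀ n, IsCohenMacaulay R (dimGraded R M n))
    {P m : Ideal R} [P.IsPrime] [hm : m.IsMaximal] (hPm : P ≤ m) {c : ℕ}
    (hc : ringKrullDim (Localization.AtPrime m ⧸
      P.map (algebraMap R (Localization.AtPrime m))) = c)
    {p : Ideal R} (hp : p ∈ associatedPrimes R M) (hpP : p ≤ P) :
    ringKrullDim (R ⧸ p) =
      ringKrullDim (Localization.AtPrime P ⧸ p.map (algebraMap R (Localization.AtPrime P))) +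
        c := by
  have := hp.isPrime
  obtain ⟨n, hn⟩ := exists_ringKrullDim_quotient_map_eq m (hpP.trans hPm)
  rw [← hdim p hp m (hpP.trans hPm)] at hn
  have hpC := mem_associatedPrimes_dimGraded hp hn
  have hsupp := mem_support_of_mem_associatedPrimes (p := ⟨p, this⟩) hpC
  obtain ⟨k, hk⟩ := isCohenMacaulay_iff.1 (hCM n) ⟨m, hm.isPrime⟩
    (Module.mem_support_mono (PrimeSpectrum.asIdeal_le_asIdeal _ _ |>.1 (hpP.trans hPm)) hsupp) hm
  have hkn : (k : WithBot ℕ∞) = n :=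
    hk.2.symm.trans (supportDim_localization_dimGraded hdim hp (hpP.trans hPm) hn)
  -- Here `c + j = n`, and unmixedness of the localized piece at `P` identifies `j` with `dim
  -- R_P/pR_P`.
  obtain ⟨j, hj, hjk⟩ := hk.exists_localization hPm
    (Module.mem_support_mono (PrimeSpectrum.asIdeal_le_asIdeal _ _ |>.1 hpP) hsupp)
  rw [hj.ringKrullDim_quotient_eq ((map_mem_associatedPrimes_iff P
    (LocalizedModule.mkLinearMap P.primeCompl _) hpP).2 hpC), hn, ← hkn, ← hjk, hc, add_comm]

end LocalToGlobal

end SeqCM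

theorem theorem1p1 {R : Type*} [CommRing R] [IsNoetherianRing R]
    {M : Type*} [AddCommGroup M] [Module R M] [Module.Finite R M]
    (hdim : ∀ p ∈ associatedPrimes R M, ∀ (P : Ideal R) [P.IsMaximal], p ≤ P →
      ringKrullDim (R ⧸ p) =
        ringKrullDim (Localization.AtPrime P ⧸ p.map (algebraMap R (Localization.AtPrime P)))) :
    SeqCM.IsSequentiallyCohenMacaulay R M ↔
      ∀ P ∈ Module.support R M,
        SeqCM.IsSequentiallyCohenMacaulay (Localization.AtPrime P.asIdeal)
          (LocalizedModule.AtPrime P.asIdeal M) := by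
  obtain ⟨b, hb⟩ := SeqCM.exists_supportDim_lt hdim
  rw [SeqCM.isSequentiallyCohenMacaulay_iff hb]
  have hlocal : ∀ P : PrimeSpectrum R,
      SeqCM.IsSequentiallyCohenMacaulay (Localization.AtPrime P.asIdeal)
        (LocalizedModule.AtPrime P.asIdeal M) ↔ ∀ n, SeqCM.IsCohenMacaulay
          (Localization.AtPrime P.asIdeal) (SeqCM.dimGraded (Localization.AtPrime P.asIdeal)
            (LocalizedModule.AtPrime P.asIdeal M) n) := fun P => by
    obtain ⟨d, hd⟩ := SeqCM.exists_natCast_eq (ringKrullDim_ne_bot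
      (R := Localization.AtPrime P.asIdeal)) ringKrullDim_lt_top
    exact SeqCM.isSequentiallyCohenMacaulay_iff (b := d + 1) <| SeqCM.withBot_lt_succ_iff.2 <|
      (Module.supportDim_le_ringKrullDim _ _).trans hd.le
  constructor
  · intro hCM P hP
    rw [hlocal]
    intro n
    rw [SeqCM.isCohenMacaulay_iff_of_isLocalRing]
    intro hnt
    obtain ⟨m, hm, hPm⟩ := Ideal.exists_le_maximal P.asIdeal P.2.ne_top
    obtain ⟨c, hc⟩ := SeqCM.exists_ringKrullDim_quotient_map_eq m hPm
    obtain ⟨e⟩ := SeqCM.nonempty_dimGraded_localization P.asIdeal (c := c)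
      (fun p hp hpP => SeqCM.ringKrullDim_quotient_eq_add hdim hCM hPm hc hp hpP) n
    have hsupp : P ∈ Module.support R (SeqCM.dimGraded R M (n + c)) :=
      Module.mem_support_iff.2 e.symm.toEquiv.nontrivial
    obtain ⟨k, hk⟩ := SeqCM.isCohenMacaulay_iff.1 (hCM (n + c)) ⟨m, hm.isPrime⟩
      (Module.mem_support_mono ((PrimeSpectrum.asIdeal_le_asIdeal _ _).1 hPm) hsupp) hm
    obtain ⟨j, hj, -⟩ := hk.exists_localization hPm hsupp
    exact ⟨j, hj.congr e.symm⟩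
  · intro h n
    rw [SeqCM.isCohenMacaulay_iff]
    intro P hP hmax
    -- At a maximal ideal the hypothesis says precisely that the shift is zero.
    obtain ⟨e⟩ := SeqCM.nonempty_dimGraded_localization P.asIdeal (M := M) (c := 0)
      (fun p hp hpP => by rw [hdim p hp P.asIdeal hpP]; simp) n
    have hPM : P ∈ Module.support R M :=
      Module.support_subset_of_injective (SeqCM.dimTrunc R M (n + 1)).subtype
        (Submodule.injective_subtype _)
        (Module.support_subset_of_surjective _ (Submodule.mkQ_surjective _) hP)
    have : Nontrivial (LocalizedModule.AtPrime P.asIdeal (SeqCM.dimGraded R M n)) :=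
      Module.mem_support_iff.1 hP
    obtain ⟨k, hk⟩ := SeqCM.isCohenMacaulay_iff_of_isLocalRing.1 ((hlocal P).1 (h P hPM) n)
      e.toEquiv.nontrivial
    exact ⟨k, hk.congr e⟩
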